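/- Let $\mathbb{K}$ be a field and $R=\mathbb{K}[x_1,\ldots,x_n]$ with the standard grading. For a monomial ideal $I$ of $R$ let $G(I)$ be its minimal set of monomial generators, and for $\mathbf{u}\in G(I)$ let $I\setminus_{\mathbf{u}}$ be the ideal generated by $G(I)\setminus\{\mathbf{u}\}$. A homogeneous ideal $I$ has a linear resolution if there is an integer $d$ such that its graded Betti numbers satisfy $\beta_{i,j}(I)=0$ for all $i,j$ with $j-i\neq d$ (so the zero ideal has a linear resolution). A critical linear ideal is a monomial ideal $J$ that has a linear resolution while, for every $\mathbf{u}\in G(J)$, the ideal $J\setminus_{\mathbf{u}}$ has none (so the zero ideal is critical linear). For monomial ideals $J\subseteq I$, we say that $I$ is linear over $J$ if there are an integer $r\ge 0$ and monomials $\mathbf{u}_1,\ldots,\mathbf{u}_r$ such that $G(I)=G(J)\cup\{\mathbf{u}_1,\ldots,\mathbf{u}_r\}$ and, for $i=1,\ldots,r$, the colon ideal $(J,\mathbf{u}_1,\ldots,\mathbf{u}_{i-1}):\mathbf{u}_i$ is generated by linear forms (the zero ideal counts as generated by the empty set of linear forms). In particular $I$ is linear over itself. Let $I$ be a monomial ideal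 of $R$ generated in a single degree, that is, all elements of $G(I)$ have the same degree. Then $I$ has a linear resolution if and only if there is a critical linear ideal $J$ of $R$ such that $I$ is linear over $J$. -/

import Mathlib

open MvPolynomial

namespace LinRes

variable {K : Type*} [Field K] {n : ℕ}

/-- The ideal of `K[x_1, …, x_n]` generated by the monomials with exponent vector in `S`. -/
noncomputable def monomialSpan (K : Type*) [Field K] {n : ℕ} (S : Set (Fin n →₀ ℕ)) :
    Ideal (MvPolynomial (Fin n) K) :=
  Ideal.span ((fun a => monomial a (1 : K)) '' S)

/-- A monomial ideal: an ideal generated by some set of monomials. -/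
def IsMonomialIdeal (I : Ideal (MvPolynomial (Fin n) K)) : Prop :=
  ∃ S : Set (Fin n →₀ ℕ), I = monomialSpan K S

/-- `G(I)`, the minimal monomial generators of a monomial ideal `I`, given by their exponent
vectors: the monomials of `I` that are minimal for divisibility among the monomials of `I`. -/
def minGens (I : Ideal (MvPolynomial (Fin n) K)) : Set (Fin n →₀ ℕ) :=
  {a | Minimal (fun b => monomial b (1 : K) ∈ I) a}

/-- All minimal monomial generators of `I` have the same degree. -/
def GeneratedInSingleDegree (I : Ideal (MvPolynomial (Fin n) K)) : Prop :=
  ∃ d : ℕ, ∀ a ∈ minGens I, a.degree = d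

/-- The ideal generated by all minimal monomial generators of `I` except `u`. -/
noncomputable def dropGen (I : Ideal (MvPolynomial (Fin n) K)) (u : Fin n →₀ ℕ) :
    Ideal (MvPolynomial (Fin n) K) :=
  monomialSpan K (minGens I \ {u})

/-- A minimal graded free resolution `0 → F_p → ⋯ → F_1 → F_0 → I → 0` of a homogeneous ideal `I`
of `R = K[x_1, …, x_n]` (standard grading). Here `F_i` is the graded free module
`⨁_b R(-deg i b)`, with `b` in `Fin (rank i)`, realised as `Fin (rank i) → R` whose `b`-th
standard basis vector has degree `deg i b`; the augmentation `F_0 → I` is given as a map to `R`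
with image `I`. (Nonnegative degrees suffice since `I` lives in nonnegative degrees.) -/
structure MinGradedFreeRes (I : Ideal (MvPolynomial (Fin n) K)) where
  rank : ℕ → ℕ
  deg : (i : ℕ) → Fin (rank i) → ℕ
  aug : (Fin (rank 0) → MvPolynomial (Fin n) K) →ₗ[MvPolynomial (Fin n) K]
    MvPolynomial (Fin n) K
  diff : (i : ℕ) → (Fin (rank (i + 1)) → MvPolynomial (Fin n) K) →ₗ[MvPolynomial (Fin n) K]
    (Fin (rank i) → MvPolynomial (Fin n) K)
  /-- The image of the augmentation is `I`. -/
  range_aug : LinearMap.range aug = I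
  exact_zero : Function.Exact (diff 0) aug
  exact_succ : ∀ i, Function.Exact (diff (i + 1)) (diff i)
  /-- The augmentation preserves degrees. -/
  aug_graded : ∀ b, (aug (Pi.single b 1)).IsHomogeneous (deg 0 b)
  /-- The differentials preserve degrees: each monomial in the coefficient at `c` of the image of
  the basis vector `b` has degree `deg b - deg c`. -/
  diff_graded : ∀ i b c, ∀ m ∈ (diff i (Pi.single b 1) c).support,
    deg i c + m.degree = deg (i + 1) b
  /-- Minimality: the entries of the differentials lie in the ideal `(x_1, …, x_n)`. -/
  minimal : ∀ i b c, diff i (Pi.single b 1) c ∈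
    Ideal.span (Set.range (X : Fin n → MvPolynomial (Fin n) K))
  finite_length : ∃ p, ∀ i, p < i → rank i = 0

/-- The graded Betti number `β_{i,j}`: the number of copies of `R(-j)` in `F_i`. As minimal graded
free resolutions are unique up to isomorphism, it depends only on `I`. -/
def MinGradedFreeRes.betti {I : Ideal (MvPolynomial (Fin n) K)} (F : MinGradedFreeRes I)
    (i j : ℕ) : ℕ :=
  Fintype.card {b : Fin (F.rank i) // F.deg i b = j}

/-- `I` has a `d`-linear resolution: `β_{i,j}(I) = 0` whenever `j - i ≠ d`. -/
def HasDLinearResolution (I : Ideal (MvPolynomial (Fin n) K)) (d : ℕ) : Prop :=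
  ∃ F : MinGradedFreeRes I, ∀ i j : ℕ, j ≠ i + d → F.betti i j = 0

/-- `I` has a linear resolution, i.e. a `d`-linear one for some `d`. -/
def HasLinearResolution (I : Ideal (MvPolynomial (Fin n) K)) : Prop :=
  ∃ d : ℕ, HasDLinearResolution I d

/-- A critical linear ideal: a monomial ideal with a linear resolution such that dropping any one
minimal generator destroys this property. The zero ideal is one. -/
def IsCriticalLinear (J : Ideal (MvPolynomial (Fin n) K)) : Prop :=
  IsMonomialIdeal J ∧ HasLinearResolution J ∧ ∀ u ∈ minGens J, ¬ HasLinearResolution (dropGen J u)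

/-- The ideal is generated by linear forms (homogeneous polynomials of degree one); the zero ideal
is, by the empty set, and the unit ideal is not. -/
def GeneratedByLinearForms (A : Ideal (MvPolynomial (Fin n) K)) : Prop :=
  ∃ S : Set (MvPolynomial (Fin n) K), (∀ f ∈ S, f.IsHomogeneous 1) ∧ A = Ideal.span S

/-- For monomial ideals `J ⊆ I`: `I` is linear over `J` if there are `r ≥ 0` and monomials
`u_1, …, u_r` with `G(I) = G(J) ∪ {u_1, …, u_r}` such that each colon ideal
`(J, u_1, …, u_{i-1}) : u_i` is generated by linear forms. -/
def IsLinearOver (I J : Ideal (MvPolynomial (Fin n) K)) : Prop :=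
  J ≤ I ∧ ∃ (r : ℕ) (u : Fin r → (Fin n →₀ ℕ)),
    minGens I = minGens J ∪ Set.range u ∧
    ∀ i : Fin r, GeneratedByLinearForms
      (Submodule.colon (J ⊔ monomialSpan K (u '' {j | j < i})) {monomial (u i) (1 : K)})

end LinRes

namespace LinRes

variable {K : Type*} [Field K] {n : ℕ}

/-! Forward direction: discard minimal generators one at a time as long as the remaining ideal still
has a linear resolution. Only finitely many monomials have the given degree, so this stops, at a
critical linear ideal `J`. Putting the discarded generators back in reverse order shows that `I` is
linear over `J`, provided each colon ideal `dropGen I u : u` is generated by linear forms. That is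
`HasDLinearResolution.generatedByLinearForms_colon`: the colon ideal consists of the coefficients of
`u` in the first syzygies of `I`, and these syzygies are generated by linear ones.

Backward direction: adding a monomial `u` of degree `d` to a `d`-linear ideal keeps it `d`-linear if
the colon ideal has a 1-linear resolution (`IsLinearIdeal.sup_span_singleton`, a horseshoe argument
resting on `HasLinearSyzygies.append`). A colon of a monomial ideal by a monomial that is generated
by linear forms is generated by variables, and such ideals are 1-linear by adding the variables one
by one (`isLinearIdeal_span_X_image`).

The inductions use the recursive predicates `HasLinearSyzygies` and `IsLinearIdeal` rather than
resolutions as complexes; the two descriptions are translated into each other in both directions. -/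

lemma homogeneousComponent_add_mul {f g : MvPolynomial (Fin n) K} {d : ℕ} (i : ℕ)
    (hg : g.IsHomogeneous d) :
    homogeneousComponent (i + d) (f * g) = homogeneousComponent i f * g := by
  induction f using MvPolynomial.induction_on' with
  | monomial m c =>
    rw [homogeneousComponent_of_mem ((isHomogeneous_monomial c rfl).mul hg),
      homogeneousComponent_of_mem (isHomogeneous_monomial c rfl)]
    simp only [add_left_inj]
    split_ifs <;> simp
  | add p q hp hq => rw [add_mul, map_add, map_add, hp, hq, add_mul]

/-! ### Iterated linear syzygies -/

/-- `W` has a free resolution of length at most `p` all of whose maps (including the augmentation)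
are given by matrices of linear forms. -/
def HasLinearSyzygies : (p : ℕ) → {k : ℕ} →
    Submodule (MvPolynomial (Fin n) K) (Fin k → MvPolynomial (Fin n) K) → Prop
  | 0, _, W => W = ⊥
  | p + 1, k, W => ∃ (r : ℕ) (g : Fin r → Fin k → MvPolynomial (Fin n) K),
      (∀ i j, (g i j).IsHomogeneous 1) ∧ Submodule.span _ (Set.range g) = W ∧
      HasLinearSyzygies p (LinearMap.ker (Fintype.linearCombination (MvPolynomial (Fin n) K) g))

/-- `I` is generated by forms of degree `d` whose module of relations has linear syzygies. -/
def IsLinearIdeal (d p : ℕ) (I : Ideal (MvPolynomial (Fin n) K)) : Prop :=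
  ∃ (r : ℕ) (g : Fin r → MvPolynomial (Fin n) K),
    (∀ i, (g i).IsHomogeneous d) ∧ Ideal.span (Set.range g) = I ∧
    HasLinearSyzygies p (LinearMap.ker (Fintype.linearCombination (MvPolynomial (Fin n) K) g))

lemma hasLinearSyzygies_bot (p k : ℕ) : HasLinearSyzygies p
    (⊥ : Submodule (MvPolynomial (Fin n) K) (Fin k → MvPolynomial (Fin n) K)) := by
  induction p generalizing k with
  | zero => rfl
  | succ p ih =>
    refine ⟨0, Fin.elim0, fun i => i.elim0, by simp, ?_⟩
    convert ih 0
    exact Subsingleton.elim _ _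

lemma HasLinearSyzygies.succ {p k : ℕ}
    {W : Submodule (MvPolynomial (Fin n) K) (Fin k → MvPolynomial (Fin n) K)}
    (h : HasLinearSyzygies p W) : HasLinearSyzygies (p + 1) W := by
  induction p generalizing k with
  | zero =>
    obtain rfl : W = ⊥ := h
    exact hasLinearSyzygies_bot _ _
  | succ p ih =>
    obtain ⟨r, g, hg, hs, hl⟩ := h
    exact ⟨r, g, hg, hs, ih hl⟩

lemma HasLinearSyzygies.mono {p q k : ℕ} (hpq : p ≤ q)
    {W : Submodule (MvPolynomial (Fin n) K) (Fin k → MvPolynomial (Fin n) K)}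
    (h : HasLinearSyzygies p W) : HasLinearSyzygies q W := by
  induction hpq with
  | refl => exact h
  | step _ ih => exact ih.succ

/-! ### Block vectors and the horseshoe lemma -/

lemma linearCombination_append {R M : Type*} [CommRing R] [AddCommGroup M] [Module R M] {a c : ℕ}
    (g : Fin a → M) (h : Fin c → M) (x : Fin a → R) (y : Fin c → R) :
    Fintype.linearCombination R (Fin.append g h) (Fin.append x y) =
      Fintype.linearCombination R g x + Fintype.linearCombination R h y := by
  simp [Fintype.linearCombination_apply, Fin.sum_univ_add]

lemma exists_eq_append {α : Type*} {a c : ℕ} (x : Fin (a + c) → α) :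
    ∃ y z, x = Fin.append y z :=
  ⟨fun i => x (Fin.castAdd c i), fun i => x (Fin.natAdd a i), (Fin.append_castAdd_natAdd).symm⟩

lemma append_add_append {R : Type*} [Add R] {a c : ℕ} (x x' : Fin a → R) (y y' : Fin c → R) :
    Fin.append x y + Fin.append x' y' = Fin.append (x + x') (y + y') := by
  ext i
  refine Fin.addCases (fun i => ?_) (fun i => ?_) i <;> simp

lemma append_zero_zero {R : Type*} [Zero R] {a c : ℕ} :
    Fin.append (0 : Fin a → R) (0 : Fin c → R) = 0 := by
  ext i
  refine Fin.addCases (fun i => ?_) (fun i => ?_) i <;> simp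

lemma append_inj {R : Type*} {a c : ℕ} {x x' : Fin a → R} {y y' : Fin c → R} :
    Fin.append x y = Fin.append x' y' ↔ x = x' ∧ y = y' := by
  refine ⟨fun h => ⟨?_, ?_⟩, by rintro ⟨rfl, rfl⟩; rfl⟩
  · ext i
    simpa using congrFun h (Fin.castAdd c i)
  · ext i
    simpa using congrFun h (Fin.natAdd a i)

lemma linearCombination_append_append {R : Type*} [CommRing R] {a c r : ℕ}
    (l : Fin r → Fin a → R) (h : Fin r → Fin c → R) (x : Fin r → R) :
    Fintype.linearCombination R (fun k => Fin.append (l k) (h k)) x =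
      Fin.append (Fintype.linearCombination R l x) (Fintype.linearCombination R h x) := by
  ext i
  refine Fin.addCases (fun i => ?_) (fun i => ?_) i <;>
    simp [Fintype.linearCombination_apply, Finset.sum_apply]

/-- The coefficient vectors `c` for which `∑ c_i h_i` lies in the span of the `g_j`. -/
def relativeSyzygies {R M : Type*} [CommRing R] [AddCommGroup M] [Module R M] {a c : ℕ}
    (g : Fin a → M) (h : Fin c → M) : Submodule R (Fin c → R) :=
  (Submodule.span R (Set.range g)).comap (Fintype.linearCombination R h)

lemma mem_relativeSyzygies {R M : Type*} [CommRing R] [AddCommGroup M] [Module R M] {a c : ℕ}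
    {g : Fin a → M} {h : Fin c → M} {y : Fin c → R} : y ∈ relativeSyzygies g h ↔
      ∃ x, Fintype.linearCombination R g x + Fintype.linearCombination R h y = 0 := by
  rw [relativeSyzygies, Submodule.mem_comap, ← Fintype.range_linearCombination, LinearMap.mem_range]
  constructor
  · rintro ⟨x, hx⟩
    exact ⟨-x, by simp [hx]⟩
  · rintro ⟨x, hx⟩
    exact ⟨-x, by rw [map_neg, neg_eq_iff_add_eq_zero, hx]⟩

/-- Horseshoe lemma: linear syzygies of `g` and linear relative syzygies of `h` modulo `g` combine
to linear syzygies of `(g, h)`. -/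
lemma HasLinearSyzygies.append.{u} {K : Type u} [Field K] {p : ℕ} {M : Type u} [AddCommGroup M]
    [Module (MvPolynomial (Fin n) K) M] {a c : ℕ} (g : Fin a → M) (h : Fin c → M)
    (hlift : ∀ y : Fin c → MvPolynomial (Fin n) K, (∀ i, (y i).IsHomogeneous 1) →
      y ∈ relativeSyzygies g h → ∃ x : Fin a → MvPolynomial (Fin n) K,
        (∀ i, (x i).IsHomogeneous 1) ∧
        Fintype.linearCombination (MvPolynomial (Fin n) K) g x +
          Fintype.linearCombination (MvPolynomial (Fin n) K) h y = 0)
    (hg : HasLinearSyzygies p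
      (LinearMap.ker (Fintype.linearCombination (MvPolynomial (Fin n) K) g)))
    (hh : HasLinearSyzygies p (relativeSyzygies (R := MvPolynomial (Fin n) K) g h)) :
    HasLinearSyzygies p
      (LinearMap.ker (Fintype.linearCombination (MvPolynomial (Fin n) K) (Fin.append g h))) := by
  induction p generalizing M a c with
  | zero =>
    change _ = ⊥ at hg hh ⊢
    rw [Submodule.eq_bot_iff] at hg hh ⊢
    intro z hz
    obtain ⟨x, y, rfl⟩ := exists_eq_append z
    rw [LinearMap.mem_ker, linearCombination_append] at hz
    obtain rfl := hh y (mem_relativeSyzygies.2 ⟨x, hz⟩)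
    obtain rfl := hg x (by simpa using hz)
    exact append_zero_zero
  | succ p ih =>
    obtain ⟨r, u, hu, hus, hup⟩ := hg
    obtain ⟨s, v, hv, hvs, hvp⟩ := hh
    have hvmem : ∀ k, v k ∈ relativeSyzygies (R := MvPolynomial (Fin n) K) g h := fun k =>
      hvs ▸ Submodule.subset_span ⟨k, rfl⟩
    -- `M` carries no grading; `hlift` replaces it by guaranteeing that linear relative syzygies
    -- extend to full syzygies with linear entries.
    choose l hl hl0 using fun k => hlift (v k) (hv k) (hvmem k)
    set U : Fin r → Fin (a + c) → MvPolynomial (Fin n) K := fun k => Fin.append (u k) 0 with hU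
    set V : Fin s → Fin (a + c) → MvPolynomial (Fin n) K := fun k => Fin.append (l k) (v k) with hV
    have hUx : ∀ x, Fintype.linearCombination (MvPolynomial (Fin n) K) U x =
        Fin.append (Fintype.linearCombination (MvPolynomial (Fin n) K) u x) 0 := by
      intro x
      rw [hU, linearCombination_append_append u (fun _ => 0)]
      congr 1
      simp [Fintype.linearCombination_apply]
    have hVx : ∀ y, Fintype.linearCombination (MvPolynomial (Fin n) K) V y =
        Fin.append (Fintype.linearCombination (MvPolynomial (Fin n) K) l y)
          (Fintype.linearCombination (MvPolynomial (Fin n) K) v y) :=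
      fun y => linearCombination_append_append l v y
    have hgl : ∀ y, Fintype.linearCombination (MvPolynomial (Fin n) K) g
        (Fintype.linearCombination (MvPolynomial (Fin n) K) l y) +
        Fintype.linearCombination (MvPolynomial (Fin n) K) h
          (Fintype.linearCombination (MvPolynomial (Fin n) K) v y) = 0 := by
      intro y
      rw [Fintype.linearCombination_apply (MvPolynomial (Fin n) K) l,
        Fintype.linearCombination_apply (MvPolynomial (Fin n) K) v, map_sum, map_sum,
        ← Finset.sum_add_distrib]
      refine Finset.sum_eq_zero fun k _ => ?_
      rw [map_smul, map_smul, ← smul_add, hl0, smul_zero]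
    have hspu : ∀ x, x ∈ LinearMap.ker (Fintype.linearCombination (MvPolynomial (Fin n) K) g) ↔
        ∃ w, Fintype.linearCombination (MvPolynomial (Fin n) K) u w = x := by
      intro x
      rw [← hus, ← Fintype.range_linearCombination, LinearMap.mem_range]
    have hspv : ∀ x, x ∈ relativeSyzygies (R := MvPolynomial (Fin n) K) g h ↔
        ∃ w, Fintype.linearCombination (MvPolynomial (Fin n) K) v w = x := by
      intro x
      rw [← hvs, ← Fintype.range_linearCombination, LinearMap.mem_range]
    have hker : LinearMap.ker (Fintype.linearCombination (MvPolynomial (Fin n) K) U) =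
        LinearMap.ker (Fintype.linearCombination (MvPolynomial (Fin n) K) u) := by
      ext x
      rw [LinearMap.mem_ker, hUx, LinearMap.mem_ker, ← append_zero_zero, append_inj]
      simp
    -- The second block of a relation is a relation among the `v k`. Conversely, if `y` is such a
    -- relation, then `∑ y k • l k` is a syzygy of `g`, hence a combination of the `u k`. So the
    -- induction hypothesis applies to `U`, `V` with the next syzygies of `u` and `v`.
    have hrel : relativeSyzygies (R := MvPolynomial (Fin n) K) U V =
        LinearMap.ker (Fintype.linearCombination (MvPolynomial (Fin n) K) v) := by
      ext y
      rw [mem_relativeSyzygies, LinearMap.mem_ker]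
      constructor
      · rintro ⟨x, hx⟩
        rw [hUx, hVx, append_add_append, ← append_zero_zero, append_inj] at hx
        simpa using hx.2
      · intro hy
        have h1 := hgl y
        rw [hy, map_zero, add_zero] at h1
        obtain ⟨w, hw⟩ := (hspu _).1 h1
        refine ⟨-w, ?_⟩
        rw [hUx, hVx, append_add_append, ← append_zero_zero, append_inj, map_neg, hw, hy]
        simp
    refine ⟨r + s, Fin.append U V, ?_, ?_, ih U V ?_ (hker ▸ hup) (hrel ▸ hvp)⟩
    · intro i j
      refine Fin.addCases (fun i => ?_) (fun i => ?_) i <;>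
      refine Fin.addCases (fun j => ?_) (fun j => ?_) j
      · simpa [hU] using hu i j
      · simpa [hU] using isHomogeneous_zero _ _ _
      · simpa [hV] using hl i j
      · simpa [hV] using hv i j
    · ext z
      rw [← Fintype.range_linearCombination, LinearMap.mem_range, LinearMap.mem_ker]
      constructor
      · rintro ⟨w, rfl⟩
        obtain ⟨x, y, rfl⟩ := exists_eq_append w
        rw [linearCombination_append, hUx, hVx, append_add_append, linearCombination_append,
          map_add, (hspu _).2 ⟨x, rfl⟩, zero_add, zero_add, hgl]
      · intro hz
        obtain ⟨x, y, rfl⟩ := exists_eq_append z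
        rw [linearCombination_append] at hz
        obtain ⟨b, rfl⟩ := (hspv y).1 (mem_relativeSyzygies.2 ⟨x, hz⟩)
        have h1 : x - Fintype.linearCombination (MvPolynomial (Fin n) K) l b ∈
            LinearMap.ker (Fintype.linearCombination (MvPolynomial (Fin n) K) g) := by
          rw [LinearMap.mem_ker, map_sub, sub_eq_zero]
          exact add_right_cancel (hz.trans (hgl b).symm)
        obtain ⟨w, hw⟩ := (hspu _).1 h1
        refine ⟨Fin.append w b, ?_⟩
        rw [linearCombination_append, hUx, hVx, append_add_append, hw]
        simp
    -- The lifting property passes to `U`, `V`: all their entries and all `y i` are linear, so the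
    -- degree 2 part of a relation involves only the degree 1 parts of the `x i`.
    · intro y hy hy'
      obtain ⟨x, hx⟩ := mem_relativeSyzygies.1 hy'
      refine ⟨fun i => homogeneousComponent 1 (x i),
        fun i => homogeneousComponent_isHomogeneous _ _, ?_⟩
      have hUh : ∀ i j, (U i j).IsHomogeneous 1 := by
        intro i j
        refine Fin.addCases (fun j => ?_) (fun j => ?_) j
        · simpa [hU] using hu i j
        · simpa [hU] using isHomogeneous_zero _ _ _
      have hVh : ∀ i j, (V i j).IsHomogeneous 1 := by
        intro i j
        refine Fin.addCases (fun j => ?_) (fun j => ?_) j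
        · simpa [hV] using hl i j
        · simpa [hV] using hv i j
      ext1 j
      have := congrArg (homogeneousComponent (1 + 1)) (congrFun hx j)
      simp only [Fintype.linearCombination_apply, Pi.add_apply, Finset.sum_apply, Pi.smul_apply,
        smul_eq_mul, map_add, map_sum, Pi.zero_apply, map_zero] at this ⊢
      rw [← this]
      congr 1
      · exact Finset.sum_congr rfl fun i _ => (homogeneousComponent_add_mul 1 (hUh i j)).symm
      · exact Finset.sum_congr rfl fun i _ =>
          (homogeneousComponent_eq_self ((hy i).mul (hVh i j))).symm

/-! ### Linear ideals: adding one generator, ideals of variables -/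

lemma IsLinearIdeal.mono {d p q : ℕ} (hpq : p ≤ q) {I : Ideal (MvPolynomial (Fin n) K)}
    (h : IsLinearIdeal d p I) : IsLinearIdeal d q I :=
  let ⟨r, g, hg, hs, hl⟩ := h
  ⟨r, g, hg, hs, hl.mono hpq⟩

lemma isLinearIdeal_bot (d p : ℕ) :
    IsLinearIdeal d p (⊥ : Ideal (MvPolynomial (Fin n) K)) := by
  refine ⟨0, Fin.elim0, fun i => i.elim0, by simp, ?_⟩
  convert hasLinearSyzygies_bot p 0
  exact Subsingleton.elim _ _

/-- Adding a form of degree `d` with linear colon ideal preserves `d`-linearity. -/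
lemma IsLinearIdeal.sup_span_singleton {d p : ℕ} {J : Ideal (MvPolynomial (Fin n) K)}
    {u : MvPolynomial (Fin n) K} (hu : u.IsHomogeneous d) (hJ : IsLinearIdeal d (p + 1) J)
    (hc : IsLinearIdeal 1 p (Submodule.colon J {u})) :
    IsLinearIdeal d (p + 1) (J ⊔ Ideal.span {u}) := by
  obtain ⟨r, g, hg, rfl, hl⟩ := hJ
  obtain ⟨s, v, hv, hvs, hvl⟩ := hc
  have hrange : Set.range (Fin.append g ![u]) = Set.range g ∪ {u} := by
    ext x
    constructor
    · rintro ⟨i, rfl⟩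
      refine Fin.addCases (fun i => ?_) (fun i => ?_) i <;> simp
    · rintro (⟨i, rfl⟩ | rfl)
      · exact ⟨Fin.castAdd 1 i, by simp⟩
      · exact ⟨Fin.natAdd r 0, by simp⟩
  refine ⟨r + 1, Fin.append g ![u], ?_, ?_, HasLinearSyzygies.append g ![u] ?_ hl ?_⟩
  · intro i
    refine Fin.addCases (fun i => ?_) (fun i => ?_) i
    · simpa using hg i
    · simpa using hu
  · rw [hrange, Ideal.span_union]
  · intro y hy hy'
    obtain ⟨x, hx⟩ := mem_relativeSyzygies.1 hy'
    refine ⟨fun i => homogeneousComponent 1 (x i),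
      fun i => homogeneousComponent_isHomogeneous _ _, ?_⟩
    have := congrArg (homogeneousComponent (1 + d)) hx
    simp only [Fintype.linearCombination_apply, smul_eq_mul, map_add, map_sum, map_zero] at this ⊢
    rw [← this]
    congr 1
    · exact Finset.sum_congr rfl fun i _ => (homogeneousComponent_add_mul 1 (hg i)).symm
    · refine Finset.sum_congr rfl fun i _ =>
        (homogeneousComponent_eq_self ((hy i).mul ?_)).symm
      simpa using hu
  -- Relative syzygies of the single element `u` are the colon ideal, viewed in a free module of
  -- rank 1. Its generators `v` form one extra stage, whence `p` for the colon ideal and `p + 1` for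
  -- `J`.
  · refine ⟨s, fun i _ => v i, fun i _ => hv i, ?_, ?_⟩
    · ext y
      rw [← Fintype.range_linearCombination, LinearMap.mem_range, relativeSyzygies,
        Submodule.mem_comap]
      have h1 : y 0 ∈ Submodule.colon (Ideal.span (Set.range g)) {u} ↔
          ∃ w, Fintype.linearCombination (MvPolynomial (Fin n) K) v w = y 0 := by
        rw [← hvs, Ideal.span, ← Fintype.range_linearCombination, LinearMap.mem_range]
      rw [Submodule.mem_colon_singleton] at h1
      have h2 : Fintype.linearCombination (MvPolynomial (Fin n) K) ![u] y = y 0 • u := by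
        simp [Fintype.linearCombination_apply]
      rw [h2]
      refine Iff.trans ?_ h1.symm
      refine exists_congr fun w => ?_
      rw [funext_iff, Fin.forall_fin_one]
      simp [Fintype.linearCombination_apply, Finset.sum_apply]
    · convert hvl using 1
      ext y
      rw [LinearMap.mem_ker, LinearMap.mem_ker, funext_iff, Fin.forall_fin_one]
      simp [Fintype.linearCombination_apply, Finset.sum_apply]

/-- A variable outside `T` is a nonzerodivisor modulo the variables in `T`. -/
lemma colon_span_X_image {T : Set (Fin n)} {i : Fin n} (hi : i ∉ T) :
    Submodule.colon (Ideal.span ((X : Fin n → MvPolynomial (Fin n) K) '' T)) {X i} =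
      Ideal.span ((X : Fin n → MvPolynomial (Fin n) K) '' T) := by
  refine le_antisymm (fun f hf => ?_) fun f hf => ?_
  · rw [Submodule.mem_colon_singleton, smul_eq_mul, mem_ideal_span_X_image] at hf
    rw [mem_ideal_span_X_image]
    intro m hm
    obtain ⟨j, hj, hjm⟩ := hf (m + Finsupp.single i 1) (by
      rw [mem_support_iff, coeff_mul_X]; exact mem_support_iff.1 hm)
    refine ⟨j, hj, ?_⟩
    have : i ≠ j := fun h => hi (h ▸ hj)
    simpa [Finsupp.single_apply, this] using hjm
  · exact Submodule.mem_colon_singleton.2 (Ideal.mul_mem_right _ _ hf)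

/-- This replaces the Koszul complex: when a variable is added, the colon ideal is the old ideal
again, so the induction hypothesis serves for both inputs of `IsLinearIdeal.sup_span_singleton`. -/
lemma isLinearIdeal_span_X_image (T : Finset (Fin n)) :
    IsLinearIdeal 1 T.card (Ideal.span ((X : Fin n → MvPolynomial (Fin n) K) '' T)) := by
  classical
  induction T using Finset.induction_on with
  | empty => simpa using isLinearIdeal_bot 1 0
  | insert i T hi ih =>
    rw [Finset.card_insert_of_notMem hi, Finset.coe_insert, Set.image_insert_eq,
      Ideal.span_insert, sup_comm]
    refine (ih.mono (Nat.le_succ _)).sup_span_singleton (isHomogeneous_X _ _) ?_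
    rwa [colon_span_X_image (by simpa using hi)]

/-! ### Translation to and from minimal graded free resolutions -/

lemma linearCombination_apply_single_one {R M : Type*} [CommRing R] [AddCommGroup M] [Module R M]
    {r : ℕ} (f : (Fin r → R) →ₗ[R] M) :
    Fintype.linearCombination R (fun i => f (Pi.single i 1)) = f := by
  ext i
  simp

lemma degree_eq_weight (m : Fin n →₀ ℕ) : m.degree = Finsupp.weight 1 m :=
  DFunLike.congr_fun Finsupp.degree_eq_weight_one m

lemma isHomogeneous_of_forall_mem_support {f : MvPolynomial (Fin n) K} {d : ℕ}
    (h : ∀ m ∈ f.support, m.degree = d) : f.IsHomogeneous d := by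
  intro m hm
  rw [← degree_eq_weight]
  exact h m (mem_support_iff.2 hm)

lemma degree_eq_of_mem_support {f : MvPolynomial (Fin n) K} {d : ℕ} (h : f.IsHomogeneous d)
    {m : Fin n →₀ ℕ} (hm : m ∈ f.support) : m.degree = d := by
  have := h (mem_support_iff.1 hm)
  rwa [← degree_eq_weight] at this

lemma mem_span_range_X {f : MvPolynomial (Fin n) K} (h : f.IsHomogeneous 1) :
    f ∈ Ideal.span (Set.range (X : Fin n → MvPolynomial (Fin n) K)) := by
  rw [← Set.image_univ, mem_ideal_span_X_image]
  intro m hm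
  have hm0 : m ≠ 0 := by
    rintro rfl
    simpa using degree_eq_of_mem_support h hm
  obtain ⟨i, hi⟩ := Finsupp.ne_iff.1 hm0
  exact ⟨i, trivial, hi⟩

/-- A finite free resolution of a submodule of a free module all of whose maps, including the
augmentation, have linear forms as matrix entries. -/
structure LinearFreeRes {k : ℕ}
    (W : Submodule (MvPolynomial (Fin n) K) (Fin k → MvPolynomial (Fin n) K)) where
  rank : ℕ → ℕ
  aug : (Fin (rank 0) → MvPolynomial (Fin n) K) →ₗ[MvPolynomial (Fin n) K]
    (Fin k → MvPolynomial (Fin n) K)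
  diff : (i : ℕ) → (Fin (rank (i + 1)) → MvPolynomial (Fin n) K) →ₗ[MvPolynomial (Fin n) K]
    (Fin (rank i) → MvPolynomial (Fin n) K)
  range_aug : LinearMap.range aug = W
  exact_zero : Function.Exact (diff 0) aug
  exact_succ : ∀ i, Function.Exact (diff (i + 1)) (diff i)
  aug_linear : ∀ b c, (aug (Pi.single b 1) c).IsHomogeneous 1
  diff_linear : ∀ i b c, (diff i (Pi.single b 1) c).IsHomogeneous 1
  finite_length : ∃ p, ∀ i, p < i → rank i = 0

lemma HasLinearSyzygies.nonempty_linearFreeRes {p k : ℕ}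
    {W : Submodule (MvPolynomial (Fin n) K) (Fin k → MvPolynomial (Fin n) K)}
    (h : HasLinearSyzygies p W) : Nonempty (LinearFreeRes W) := by
  induction p generalizing k with
  | zero =>
    obtain rfl : W = ⊥ := h
    exact ⟨{
      rank := fun _ => 0
      aug := 0
      diff := fun _ => 0
      range_aug := LinearMap.range_zero
      exact_zero := fun x => by simp [Subsingleton.elim x 0]
      exact_succ := fun _ x => by simp [Subsingleton.elim x 0]
      aug_linear := fun b => b.elim0
      diff_linear := fun _ b => b.elim0
      finite_length := ⟨0, fun _ _ => rfl⟩ }⟩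
  | succ p ih =>
    obtain ⟨r, g, hg, rfl, hl⟩ := h
    obtain ⟨F⟩ := ih hl
    obtain ⟨q, hq⟩ := F.finite_length
    exact ⟨{
      rank := fun i => match i with
        | 0 => r
        | i + 1 => F.rank i
      aug := Fintype.linearCombination _ g
      diff := fun i => match i with
        | 0 => F.aug
        | i + 1 => F.diff i
      range_aug := Fintype.range_linearCombination _ _
      exact_zero := LinearMap.exact_iff.2 F.range_aug.symm
      exact_succ := fun i => match i with
        | 0 => F.exact_zero
        | i + 1 => F.exact_succ i
      aug_linear := fun b c => by simpa using hg b c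
      diff_linear := fun i => match i with
        | 0 => F.aug_linear
        | i + 1 => F.diff_linear i
      finite_length := ⟨q + 1, fun i hi => match i, hi with
        | i + 1, hi => hq i (Nat.lt_of_succ_lt_succ hi)⟩ }⟩

/-- Minimality is automatic, since linear forms lie in the ideal of the variables. -/
lemma IsLinearIdeal.hasDLinearResolution {d p : ℕ} {I : Ideal (MvPolynomial (Fin n) K)}
    (h : IsLinearIdeal d p I) : HasDLinearResolution I d := by
  obtain ⟨r, g, hg, rfl, hl⟩ := h
  obtain ⟨F⟩ := hl.nonempty_linearFreeRes
  obtain ⟨q, hq⟩ := F.finite_length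
  refine ⟨{
    rank := fun i => match i with
      | 0 => r
      | i + 1 => F.rank i
    deg := fun i _ => i + d
    aug := Fintype.linearCombination _ g
    diff := fun i => match i with
      | 0 => F.aug
      | i + 1 => F.diff i
    range_aug := Fintype.range_linearCombination _ _
    exact_zero := LinearMap.exact_iff.2 F.range_aug.symm
    exact_succ := fun i => match i with
      | 0 => F.exact_zero
      | i + 1 => F.exact_succ i
    aug_graded := fun b => by simpa using hg b
    diff_graded := fun i b c m hm => by
      have : m.degree = 1 := match i, b, c, hm with
        | 0, b, c, hm => degree_eq_of_mem_support (F.aug_linear b c) hm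
        | i + 1, b, c, hm => degree_eq_of_mem_support (F.diff_linear i b c) hm
      omega
    minimal := fun i => match i with
      | 0 => fun b c => mem_span_range_X (F.aug_linear b c)
      | i + 1 => fun b c => mem_span_range_X (F.diff_linear i b c)
    finite_length := ⟨q + 1, fun i hi => match i, hi with
      | i + 1, hi => hq i (Nat.lt_of_succ_lt_succ hi)⟩ }, fun i j hj => ?_⟩
  refine Fintype.card_eq_zero_iff.2 ⟨fun b => hj b.2.symm⟩

lemma MinGradedFreeRes.deg_eq {I : Ideal (MvPolynomial (Fin n) K)} (F : MinGradedFreeRes I) {d : ℕ}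
    (hF : ∀ i j : ℕ, j ≠ i + d → F.betti i j = 0) (i : ℕ) (b : Fin (F.rank i)) :
    F.deg i b = i + d := by
  by_contra hb
  exact (Fintype.card_eq_zero_iff.1 (hF i _ hb)).elim ⟨b, rfl⟩

lemma MinGradedFreeRes.isHomogeneous_aug {I : Ideal (MvPolynomial (Fin n) K)}
    (F : MinGradedFreeRes I) {d : ℕ} (hF : ∀ i j : ℕ, j ≠ i + d → F.betti i j = 0)
    (b : Fin (F.rank 0)) : (F.aug (Pi.single b 1)).IsHomogeneous d := by
  simpa [F.deg_eq hF] using F.aug_graded b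

lemma MinGradedFreeRes.isHomogeneous_diff {I : Ideal (MvPolynomial (Fin n) K)}
    (F : MinGradedFreeRes I) {d : ℕ} (hF : ∀ i j : ℕ, j ≠ i + d → F.betti i j = 0)
    (i : ℕ) (b c) : (F.diff i (Pi.single b 1) c).IsHomogeneous 1 := by
  refine isHomogeneous_of_forall_mem_support fun m hm => ?_
  have := F.diff_graded i b c m hm
  rw [F.deg_eq hF, F.deg_eq hF] at this
  omega

lemma MinGradedFreeRes.span_aug {I : Ideal (MvPolynomial (Fin n) K)} (F : MinGradedFreeRes I) :
    Ideal.span (Set.range fun b => F.aug (Pi.single b 1)) = I := by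
  rw [Ideal.span, ← Fintype.range_linearCombination, linearCombination_apply_single_one,
    F.range_aug]

/-- By exactness the kernel of `F.diff i` is generated by the columns of `F.diff (i + 1)`, which are
linear. The number `m` of remaining stages decreases as `i` grows, and for `i ≥ q` the source of
`F.diff i` is zero. -/
lemma MinGradedFreeRes.hasLinearSyzygies {I : Ideal (MvPolynomial (Fin n) K)}
    (F : MinGradedFreeRes I) {d : ℕ} (hF : ∀ i j : ℕ, j ≠ i + d → F.betti i j = 0) {q : ℕ}
    (hq : ∀ i, q < i → F.rank i = 0) (m i : ℕ) (hm : q ≤ i + m) :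
    HasLinearSyzygies m (LinearMap.ker (F.diff i)) := by
  induction m generalizing i with
  | zero =>
    have : IsEmpty (Fin (F.rank (i + 1))) := by
      rw [hq (i + 1) (by omega)]
      infer_instance
    exact Subsingleton.elim _ _
  | succ m ih =>
    refine ⟨F.rank (i + 2), fun b => F.diff (i + 1) (Pi.single b 1),
      F.isHomogeneous_diff hF (i + 1), ?_, ?_⟩
    · rw [← Fintype.range_linearCombination, linearCombination_apply_single_one,
        LinearMap.exact_iff.1 (F.exact_succ i)]
    · rw [linearCombination_apply_single_one]
      exact ih (i + 1) (by omega)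

lemma HasDLinearResolution.exists_isLinearIdeal {d : ℕ} {I : Ideal (MvPolynomial (Fin n) K)}
    (h : HasDLinearResolution I d) : ∃ p, IsLinearIdeal d p I := by
  obtain ⟨F, hF⟩ := h
  obtain ⟨q, hq⟩ := F.finite_length
  refine ⟨q + 1, F.rank 0, fun b => F.aug (Pi.single b 1), F.isHomogeneous_aug hF, F.span_aug, ?_⟩
  rw [linearCombination_apply_single_one]
  refine ⟨F.rank 1, fun b => F.diff 0 (Pi.single b 1), F.isHomogeneous_diff hF 0, ?_, ?_⟩
  · rw [← Fintype.range_linearCombination, linearCombination_apply_single_one,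
      LinearMap.exact_iff.1 F.exact_zero]
  · rw [linearCombination_apply_single_one]
    exact F.hasLinearSyzygies hF hq q 0 (by omega)

/-! ### Monomial ideals and their minimal generators -/

lemma mem_monomialSpan {S : Set (Fin n →₀ ℕ)} {f : MvPolynomial (Fin n) K} :
    f ∈ monomialSpan K S ↔ ∀ m ∈ f.support, ∃ a ∈ S, a ≤ m :=
  mem_ideal_span_monomial_image

lemma monomial_mem_monomialSpan {S : Set (Fin n →₀ ℕ)} {m : Fin n →₀ ℕ} :
    monomial m (1 : K) ∈ monomialSpan K S ↔ ∃ a ∈ S, a ≤ m := by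
  classical
  rw [mem_monomialSpan, support_monomial, if_neg one_ne_zero]
  simp

lemma monomial_mem_of_mem_minGens {I : Ideal (MvPolynomial (Fin n) K)} {a : Fin n →₀ ℕ}
    (ha : a ∈ minGens I) : monomial a (1 : K) ∈ I :=
  Minimal.prop (P := fun b => monomial b (1 : K) ∈ I) ha

lemma IsMonomialIdeal.monomialSpan_minGens {I : Ideal (MvPolynomial (Fin n) K)}
    (hI : IsMonomialIdeal I) : monomialSpan K (minGens I) = I := by
  obtain ⟨S, rfl⟩ := hI
  ext f
  rw [mem_monomialSpan, mem_monomialSpan]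
  refine forall₂_congr fun m _ => ⟨?_, ?_⟩
  · rintro ⟨a, ha, ham⟩
    obtain ⟨b, hb, hba⟩ := monomial_mem_monomialSpan.1 (monomial_mem_of_mem_minGens ha)
    exact ⟨b, hb, hba.trans ham⟩
  · rintro ⟨a, ha, ham⟩
    obtain ⟨b, hba, hb⟩ := exists_minimal_le_of_wellFoundedLT
      (fun b => monomial b (1 : K) ∈ monomialSpan K S) a
      (monomial_mem_monomialSpan.2 ⟨a, ha, le_rfl⟩)
    exact ⟨b, hb, hba.trans ham⟩

lemma isAntichain_minGens (I : Ideal (MvPolynomial (Fin n) K)) :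
    IsAntichain (· ≤ ·) (minGens I) :=
  setOfPred_minimal_antichain _

lemma minGens_monomialSpan {S : Set (Fin n →₀ ℕ)} (hS : IsAntichain (· ≤ ·) S) :
    minGens (monomialSpan K S) = S := by
  ext a
  constructor
  · intro ha
    obtain ⟨b, hb, hba⟩ := monomial_mem_monomialSpan.1 (monomial_mem_of_mem_minGens ha)
    exact hba.antisymm (ha.2 (monomial_mem_monomialSpan.2 ⟨b, hb, le_rfl⟩) hba) ▸ hb
  · intro ha
    refine ⟨monomial_mem_monomialSpan.2 ⟨a, ha, le_rfl⟩, fun b hb hba => ?_⟩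
    obtain ⟨c, hc, hcb⟩ := monomial_mem_monomialSpan.1 hb
    exact (hS.eq hc ha (hcb.trans hba)) ▸ hcb

lemma minGens_dropGen (I : Ideal (MvPolynomial (Fin n) K)) (u : Fin n →₀ ℕ) :
    minGens (dropGen I u) = minGens I \ {u} :=
  minGens_monomialSpan ((isAntichain_minGens I).subset Set.sdiff_subset)

lemma monomialSpan_union (S T : Set (Fin n →₀ ℕ)) :
    monomialSpan K (S ∪ T) = monomialSpan K S ⊔ monomialSpan K T := by
  rw [monomialSpan, Set.image_union, Ideal.span_union, monomialSpan, monomialSpan]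

lemma mem_span_of_isHomogeneous_le_degree {r d : ℕ} {g : Fin r → MvPolynomial (Fin n) K}
    (hg : ∀ i, (g i).IsHomogeneous d) {f : MvPolynomial (Fin n) K}
    (hf : f ∈ Ideal.span (Set.range g)) {m : Fin n →₀ ℕ} (hm : m ∈ f.support) : d ≤ m.degree := by
  classical
  rw [Ideal.span, ← Fintype.range_linearCombination] at hf
  obtain ⟨c, rfl⟩ := hf
  rw [Fintype.linearCombination_apply] at hm
  obtain ⟨i, -, hi⟩ := Finset.mem_biUnion.1 (support_sum hm)
  obtain ⟨a, -, b, hb, rfl⟩ := Finset.mem_add.1 (support_mul _ _ hi)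
  rw [map_add, degree_eq_of_mem_support (hg i) hb]
  exact Nat.le_add_left _ _

/-- The degree of homogeneous generators of a nonzero monomial ideal generated in a single degree
is that degree. -/
lemma degree_eq_of_span_range_eq {r d e : ℕ} {g : Fin r → MvPolynomial (Fin n) K}
    (hg : ∀ i, (g i).IsHomogeneous d) {S : Set (Fin n →₀ ℕ)} (hS : ∀ a ∈ S, a.degree = e)
    (hne : S.Nonempty) (h : Ideal.span (Set.range g) = monomialSpan K S) : d = e := by
  classical
  obtain ⟨a, ha⟩ := hne
  have ha' : monomial a (1 : K) ∈ Ideal.span (Set.range g) :=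
    h ▸ monomial_mem_monomialSpan.2 ⟨a, ha, le_rfl⟩
  refine le_antisymm ?_ ?_
  · rw [← hS a ha]
    exact mem_span_of_isHomogeneous_le_degree hg ha' (by simp [support_monomial])
  · obtain ⟨i, hi⟩ : ∃ i, g i ≠ 0 := by
      by_contra! h0
      rw [Ideal.span_eq_bot.2 (by rintro _ ⟨i, rfl⟩; exact h0 i)] at ha'
      simp at ha'
    obtain ⟨m, hm⟩ := support_nonempty.2 hi
    obtain ⟨b, hb, hbm⟩ := mem_monomialSpan.1
      (h ▸ Ideal.subset_span ⟨i, rfl⟩ : g i ∈ monomialSpan K S) m hm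
    rw [← hS b hb, ← degree_eq_of_mem_support (hg i) hm]
    exact Finsupp.degree_mono hbm

lemma eq_of_le_of_degree_eq {a b : Fin n →₀ ℕ} (h : a ≤ b) (hd : a.degree = b.degree) : a = b := by
  obtain ⟨c, rfl⟩ := exists_add_of_le h
  rw [map_add, left_eq_add, Finsupp.degree_eq_zero_iff] at hd
  rw [hd, add_zero]

/-! ### Colon ideals generated by linear forms -/

/-- If `I` has a linear resolution then the relations of each minimal generator with the others
are generated by linear ones. -/
lemma HasDLinearResolution.generatedByLinearForms_colon {d : ℕ}
    {I : Ideal (MvPolynomial (Fin n) K)} (hI : IsMonomialIdeal I) (h : HasDLinearResolution I d)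
    (hd : ∀ a ∈ minGens I, a.degree = d) {u : Fin n →₀ ℕ} (hu : u ∈ minGens I) :
    GeneratedByLinearForms (Submodule.colon (dropGen I u) {monomial u (1 : K)}) := by
  classical
  obtain ⟨F, hF⟩ := h
  set f : Fin (F.rank 0) → MvPolynomial (Fin n) K := fun b => F.aug (Pi.single b 1) with hf
  have hfh : ∀ b, (f b).IsHomogeneous d := F.isHomogeneous_aug hF
  have haug : ∀ c, F.aug c = ∑ b, c b * f b := by
    intro c
    rw [← linearCombination_apply_single_one F.aug, Fintype.linearCombination_apply]
    rfl
  -- The generators `f b` of the resolution need not be monomials; `φ` reads off the coefficient of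
  -- `u` after the constant change of generators from `f` to the monomials.
  set φ := Fintype.linearCombination (MvPolynomial (Fin n) K)
    (fun b => (C (coeff u (f b)) : MvPolynomial (Fin n) K)) with hφ
  have hφa : ∀ c, φ c = ∑ b, c b * C (coeff u (f b)) := fun c => rfl
  -- Each `f b` has degree `d` and lies in `I`, so each of its monomials is a minimal generator; all
  -- but `u` lie in `dropGen I u`.
  have hmem : ∀ c, F.aug c - φ c * monomial u 1 ∈ dropGen I u := by
    intro c
    rw [haug, hφa, Finset.sum_mul, ← Finset.sum_sub_distrib]
    refine Ideal.sum_mem _ fun b _ => ?_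
    rw [mul_assoc, ← mul_sub]
    refine Ideal.mul_mem_left _ _ (mem_monomialSpan.2 fun m hm => ?_)
    rw [C_mul_monomial, mul_one, mem_support_iff, coeff_sub, coeff_monomial] at hm
    have hmu : u ≠ m := by
      rintro rfl
      simp at hm
    rw [if_neg hmu, sub_zero, ← mem_support_iff] at hm
    have hbI : f b ∈ monomialSpan K (minGens I) := by
      rw [hI.monomialSpan_minGens, ← F.range_aug]
      exact ⟨_, rfl⟩
    obtain ⟨a, ha, ham⟩ := mem_monomialSpan.1 hbI m hm
    refine ⟨a, ⟨ha, ?_⟩, ham⟩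
    rintro rfl
    exact hmu (eq_of_le_of_degree_eq ham
      ((hd _ ha).trans (degree_eq_of_mem_support (hfh b) hm).symm))
  have hlift : ∀ w ∈ minGens I, ∃ c, F.aug c = monomial w 1 ∧
      φ c = C (coeff u (monomial w (1 : K))) := by
    intro w hw
    have : monomial w (1 : K) ∈ LinearMap.range F.aug := by
      rw [F.range_aug]
      exact monomial_mem_of_mem_minGens hw
    obtain ⟨c, hc⟩ := this
    -- Both `w` and the `f b` have degree `d`, so the constant terms of the coefficients suffice. On
    -- a constant lift, `φ` is determined by `w`.
    have hw1 : ∑ b, C (coeff 0 (c b)) * f b = monomial w (1 : K) := by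
      have := congrArg (homogeneousComponent (0 + d)) hc
      rw [haug, map_sum, homogeneousComponent_eq_self
        (isHomogeneous_monomial _ (by rw [hd w hw, zero_add]))] at this
      rw [← this]
      refine Finset.sum_congr rfl fun b _ => ?_
      rw [homogeneousComponent_add_mul 0 (hfh b), homogeneousComponent_zero]
    refine ⟨fun b => C (coeff 0 (c b)), by rw [haug, hw1], ?_⟩
    rw [← hw1, hφa, coeff_sum, map_sum]
    refine Finset.sum_congr rfl fun b _ => ?_
    rw [coeff_C_mul, C_mul]
  have hdrop : dropGen I u ≤ (LinearMap.ker φ).map F.aug := by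
    refine Ideal.span_le.2 ?_
    rintro _ ⟨w, ⟨hw, hwu⟩, rfl⟩
    obtain ⟨c, hc, hc'⟩ := hlift w hw
    refine ⟨c, ?_, hc⟩
    rw [SetLike.mem_coe, LinearMap.mem_ker, hc', coeff_monomial,
      if_neg (Set.mem_singleton_iff.not.1 hwu), C_0]
  -- The colon ideal is the image under `φ` of the first syzygies. As `φ` has constant entries,
  -- linear syzygies give linear forms.
  refine ⟨Set.range fun e => φ (F.diff 0 (Pi.single e 1)), ?_, ?_⟩
  · rintro _ ⟨e, rfl⟩
    dsimp only
    rw [hφa]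
    refine IsHomogeneous.sum _ _ _ fun b _ => ?_
    simpa using (F.isHomogeneous_diff hF 0 e b).mul (isHomogeneous_C _ (coeff u (f b)))
  · refine le_antisymm (fun y hy => ?_) (Ideal.span_le.2 ?_)
    · rw [Submodule.mem_colon_singleton] at hy
      obtain ⟨c, hc, hcy⟩ := hdrop hy
      obtain ⟨c', hc', hφc'⟩ := hlift u hu
      -- Here `c` lifts `y * u` avoiding `u`, while `c'` lifts `u` itself, so the difference is a
      -- syzygy on which `φ` takes the value `y`.
      have hker : y • c' - c ∈ LinearMap.range (F.diff 0) := by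
        rw [← LinearMap.exact_iff.1 F.exact_zero, LinearMap.mem_ker, map_sub, map_smul, hc', hcy,
          sub_self]
      obtain ⟨z, hz⟩ := hker
      have hyz : φ (F.diff 0 z) = y := by
        rw [hz, map_sub, map_smul, hφc', LinearMap.mem_ker.1 hc]
        simp
      have := linearCombination_apply_single_one (φ ∘ₗ F.diff 0)
      rw [Ideal.span, ← Fintype.range_linearCombination]
      exact ⟨z, (LinearMap.congr_fun this z).trans hyz⟩
    · rintro _ ⟨e, rfl⟩
      rw [SetLike.mem_coe, Submodule.mem_colon_singleton]
      have := hmem (F.diff 0 (Pi.single e 1))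
      rwa [F.exact_zero.apply_apply_eq_zero, zero_sub, neg_mem_iff] at this

/-- A monomial ideal quotient generated by linear forms is generated by variables. -/
lemma GeneratedByLinearForms.exists_isLinearIdeal {S : Set (Fin n →₀ ℕ)} {u : Fin n →₀ ℕ}
    (h : GeneratedByLinearForms (Submodule.colon (monomialSpan K S) {monomial u (1 : K)})) :
    ∃ p, IsLinearIdeal 1 p (Submodule.colon (monomialSpan K S) {monomial u (1 : K)}) := by
  classical
  obtain ⟨L, hL, hA⟩ := h
  set A := Submodule.colon (monomialSpan K S) {monomial u (1 : K)} with hAdef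
  -- The colon ideal is again monomial, so a linear form in it has all its variables in it.
  have hmon : ∀ f ∈ A, ∀ m ∈ f.support, monomial m (1 : K) ∈ A := by
    intro f hf m hm
    rw [hAdef, Submodule.mem_colon_singleton, smul_eq_mul] at hf ⊢
    rw [monomial_mul, one_mul, monomial_mem_monomialSpan]
    refine mem_monomialSpan.1 hf (m + u) ?_
    rw [mem_support_iff, coeff_mul_monomial, mul_one]
    exact mem_support_iff.1 hm
  have hT : A = Ideal.span ((X : Fin n → MvPolynomial (Fin n) K) ''
      (Finset.univ.filter fun i => (X i : MvPolynomial (Fin n) K) ∈ A)) := by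
    refine le_antisymm ?_ (Ideal.span_le.2 ?_)
    · conv_lhs => rw [hA]
      refine Ideal.span_le.2 fun f hf => ?_
      rw [SetLike.mem_coe, mem_ideal_span_X_image]
      intro m hm
      have hfA : f ∈ A := hA ▸ Ideal.subset_span hf
      have hm1 := degree_eq_of_mem_support (hL f hf) hm
      have hm0 : m ≠ 0 := by
        rintro rfl
        simp at hm1
      obtain ⟨i, hi⟩ := Finsupp.ne_iff.1 hm0
      obtain rfl : Finsupp.single i 1 = m := eq_of_le_of_degree_eq
        (Finsupp.single_le_iff.2 (Nat.one_le_iff_ne_zero.2 hi)) (by simp [hm1])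
      refine ⟨i, ?_, by simp⟩
      exact Finset.mem_coe.2 (Finset.mem_filter.2 ⟨Finset.mem_univ _, hmon f hfA _ hm⟩)
    · rintro _ ⟨i, hi, rfl⟩
      simpa using hi
  exact ⟨_, hT ▸ isLinearIdeal_span_X_image _⟩

/-! ### The two implications -/

lemma isLinearIdeal_sup_monomialSpan {d p r : ℕ} {J : Ideal (MvPolynomial (Fin n) K)}
    (hJm : IsMonomialIdeal J) (hJ : IsLinearIdeal d p J) (u : Fin r → (Fin n →₀ ℕ))
    (hu : ∀ i, (u i).degree = d) (hc : ∀ i : Fin r, GeneratedByLinearForms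
      (Submodule.colon (J ⊔ monomialSpan K (u '' {j | j < i})) {monomial (u i) (1 : K)}))
    (k : ℕ) (hk : k ≤ r) :
    ∃ q, IsLinearIdeal d q (J ⊔ monomialSpan K (u '' {j | (j : ℕ) < k})) := by
  induction k with
  | zero => exact ⟨p, by simpa [monomialSpan] using hJ⟩
  | succ k ih =>
    obtain ⟨q, hq⟩ := ih (by omega)
    obtain ⟨S, rfl⟩ := hJm
    have hk' := hc ⟨k, hk⟩
    have hset : {j : Fin r | j < ⟨k, hk⟩} = {j : Fin r | (j : ℕ) < k} := rfl
    rw [hset, ← monomialSpan_union] at hk'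
    obtain ⟨q', hq'⟩ := hk'.exists_isLinearIdeal
    rw [monomialSpan_union] at hq'
    have hset' : {j : Fin r | (j : ℕ) < k + 1} = {j : Fin r | (j : ℕ) < k} ∪ {⟨k, hk⟩} := by
      ext j
      simp only [Set.mem_ofPred_eq, Set.mem_union, Set.mem_singleton_iff, Fin.ext_iff]
      omega
    have hsingle : monomialSpan K {u ⟨k, hk⟩} = Ideal.span {monomial (u ⟨k, hk⟩) (1 : K)} := by
      rw [monomialSpan, Set.image_singleton]
    refine ⟨max q q' + 1, ?_⟩
    rw [hset', Set.image_union, Set.image_singleton, monomialSpan_union (K := K) (u '' _),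
      ← sup_assoc, hsingle]
    exact (hq.mono (by omega)).sup_span_singleton (isHomogeneous_monomial _ (hu _))
      (hq'.mono (by omega))

/-- An ideal that is linear over an ideal with a linear resolution has a linear resolution. -/
lemma IsLinearOver.hasLinearResolution {I J : Ideal (MvPolynomial (Fin n) K)}
    (hI : IsMonomialIdeal I) (hdeg : GeneratedInSingleDegree I) (hJm : IsMonomialIdeal J)
    (hJ : HasLinearResolution J) (h : IsLinearOver I J) : HasLinearResolution I := by
  obtain ⟨e, he⟩ := hdeg
  obtain ⟨-, r, u, hG, hc⟩ := h
  have hJe : ∃ p, IsLinearIdeal e p J := by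
    obtain ⟨d, hd⟩ := hJ
    obtain ⟨p, hp⟩ := hd.exists_isLinearIdeal
    -- The zero ideal is linear for every degree, so its given `d` may differ from `e`; for nonzero
    -- `J` the degree is forced.
    rcases (minGens J).eq_empty_or_nonempty with h0 | hne
    · have := hJm.monomialSpan_minGens
      rw [h0, monomialSpan, Set.image_empty, Ideal.span_empty] at this
      exact ⟨0, this ▸ isLinearIdeal_bot e 0⟩
    · obtain ⟨s, g, hg, hs, hl⟩ := id hp
      obtain rfl := degree_eq_of_span_range_eq hg
        (fun a ha => he a (hG ▸ Set.mem_union_left _ ha)) hne (hs.trans hJm.monomialSpan_minGens.symm)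
      exact ⟨p, hp⟩
  obtain ⟨p, hp⟩ := hJe
  obtain ⟨q, hq⟩ := isLinearIdeal_sup_monomialSpan hJm hp u
    (fun i => he _ (hG ▸ Set.mem_union_right _ ⟨i, rfl⟩)) hc r le_rfl
  have hset : {j : Fin r | (j : ℕ) < r} = Set.univ := by simp
  refine ⟨e, IsLinearIdeal.hasDLinearResolution (p := q) ?_⟩
  rw [← hI.monomialSpan_minGens, hG, monomialSpan_union, hJm.monomialSpan_minGens]
  rwa [hset, Set.image_univ] at hq

lemma IsLinearOver.refl (I : Ideal (MvPolynomial (Fin n) K)) : IsLinearOver I I :=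
  ⟨le_rfl, 0, Fin.elim0, by simp, fun i => i.elim0⟩

/-- The generator `u` goes last in the list: `J` and the earlier monomials together generate
`dropGen I u`, so the only new colon ideal is the one in `hc`. -/
lemma IsLinearOver.of_dropGen {I J : Ideal (MvPolynomial (Fin n) K)} {u : Fin n →₀ ℕ}
    (hI : IsMonomialIdeal I) (hJm : IsMonomialIdeal J) (hu : u ∈ minGens I)
    (hc : GeneratedByLinearForms (Submodule.colon (dropGen I u) {monomial u (1 : K)}))
    (h : IsLinearOver (dropGen I u) J) : IsLinearOver I J := by
  obtain ⟨hJ, r, v, hG, hv⟩ := h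
  have hdrop : dropGen I u ≤ I := by
    conv_rhs => rw [← hI.monomialSpan_minGens]
    exact Ideal.span_mono (Set.image_mono Set.sdiff_subset)
  have hsup : J ⊔ monomialSpan K (Set.range v) = dropGen I u := by
    rw [← hJm.monomialSpan_minGens, ← monomialSpan_union, ← hG, minGens_dropGen, dropGen]
  refine ⟨hJ.trans hdrop, r + 1, Fin.snoc v u, ?_, fun i => ?_⟩
  · rw [minGens_dropGen] at hG
    rw [Fin.range_snoc, Set.union_insert, ← hG, Set.insert_sdiff_singleton, Set.insert_eq_of_mem hu]
  · refine Fin.lastCases ?_ (fun i => ?_) i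
    · have : (Fin.snoc v u : Fin (r + 1) → (Fin n →₀ ℕ)) '' {j | j < Fin.last r} = Set.range v := by
        ext a
        simp [Fin.exists_fin_succ']
      rw [this, hsup, Fin.snoc_last]
      exact hc
    · have : (Fin.snoc v u : Fin (r + 1) → (Fin n →₀ ℕ)) '' {j | j < i.castSucc} =
          v '' {j | j < i} := by
        ext a
        simp [Fin.exists_fin_succ', (Fin.le_last i.castSucc).not_gt]
      rw [this, Fin.snoc_castSucc]
      exact hv i

/-- Induction on the number of minimal generators: either `I` is critical already, or some generator
can be dropped without losing linearity. -/
lemma exists_isCriticalLinear_isLinearOver {d : ℕ} (I : Ideal (MvPolynomial (Fin n) K))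
    (hI : IsMonomialIdeal I) (hd : ∀ a ∈ minGens I, a.degree = d) (h : HasLinearResolution I) :
    ∃ J, IsCriticalLinear J ∧ IsLinearOver I J := by
  have hfin : (minGens I).Finite := (Finsupp.finite_of_degree_eq d).subset hd
  induction hm : (minGens I).ncard generalizing I with
  | zero =>
    rw [Set.ncard_eq_zero hfin] at hm
    exact ⟨I, ⟨hI, h, by simp [hm]⟩, .refl I⟩
  | succ m ih =>
    by_cases hcrit : ∀ u ∈ minGens I, ¬ HasLinearResolution (dropGen I u)
    · exact ⟨I, ⟨hI, h, hcrit⟩, .refl I⟩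
    push Not at hcrit
    obtain ⟨u, hu, hlin⟩ := hcrit
    have hsub : minGens (dropGen I u) ⊆ minGens I := by
      rw [minGens_dropGen]
      exact Set.sdiff_subset
    obtain ⟨J, hJ, hJI⟩ := ih (dropGen I u) ⟨_, rfl⟩ (fun a ha => hd a (hsub ha)) hlin
      (hfin.subset hsub) (by rw [minGens_dropGen, Set.ncard_sdiff_singleton_of_mem hu, hm]; rfl)
    obtain ⟨e, he⟩ := h
    obtain rfl : e = d := by
      obtain ⟨p, r, g, hg, hs, -⟩ := he.exists_isLinearIdeal
      exact degree_eq_of_span_range_eq hg hd ⟨u, hu⟩ (hs.trans hI.monomialSpan_minGens.symm)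
    exact ⟨J, hJ, hJI.of_dropGen hI hJ.1 hu (he.generatedByLinearForms_colon hI hd hu)⟩

end LinRes

theorem corollary2p8 {K : Type*} [Field K] {n : ℕ} (I : Ideal (MvPolynomial (Fin n) K))
    (hI : LinRes.IsMonomialIdeal I) (hdeg : LinRes.GeneratedInSingleDegree I) :
    LinRes.HasLinearResolution I ↔
      ∃ J : Ideal (MvPolynomial (Fin n) K), LinRes.IsCriticalLinear J ∧ LinRes.IsLinearOver I J := by
  constructor
  · obtain ⟨d, hd⟩ := hdeg
    exact LinRes.exists_isCriticalLinear_isLinearOver I hI hd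
  · rintro ⟨J, hJ, hIJ⟩
    exact hIJ.hasLinearResolution hI hdeg hJ.1 hJ.2.1
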